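/- Let $(X,d)$ be a Hadamard space, that is, a complete geodesic metric space satisfying the CAT(0) inequality. Let $X^\infty$ be its boundary at infinity, that is, the set of asymptotic classes $c(\infty)$ of geodesic rays $c:[0,\infty)\to X$ (isometric embeddings of $[0,\infty)$; two rays are asymptotic if they stay at bounded distance), with the angular metric $\angle(\xi,\xi')=\sup_{x\in X}\angle_x(c,c')$, where $c,c'$ are geodesic rays issuing from $x$ with $c(\infty)=\xi$, $c'(\infty)=\xi'$, and $\angle_x(c,c')$ is the limit, as $t\to 0^+$, of the Euclidean comparison angle at $x$ between $c(t)$ and $c'(t)$. Let $CX^\infty$ be the Euclidean cone over $X^\infty$: the set $\{r\xi : r\ge 0,\ \xi\in X^\infty\}$ in which all $0\xi$ are identified, with scaling $a(r\xi)=(ar)\xi$ for $a\ge 0$ and distance $$d^\infty(r\xi,r'\xi')^2=r^2+r'^2-2rr'\cos\angle(\xi,\xi').$$ A constant-speed ray is a map $t\mapsto c(rt)$ on $[0,\infty)$ with $c$ a geodesic ray and $r\ge 0$; its endpoint is $rc(\infty)\in CX^\infty$. Let $f:X\to\mathbb{R}$ be a continuous function that is convex along geodesics. For $p\in CX^\infty$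 define $$f^\infty(p)=\lim_{t\to\infty}\frac{f(c(t))-f(c(0))}{t}=\lim_{t\to\infty}\frac{f(c(t))}{t},$$ where $c$ is any constant-speed ray with endpoint $p$. Theorem. The two limits exist in $\mathbb{R}\cup\{\infty\}$, are equal, and do not depend on the choice of $c$, so $f^\infty:CX^\infty\to\mathbb{R}\cup\{\infty\}$ is well defined; any two points of $CX^\infty$ are joined by exactly one geodesic with respect to $d^\infty$; and $f^\infty$ is positively homogeneous and convex, that is (with $0\cdot\infty=0$), $$f^\infty(ap)=a f^\infty(p)\qquad (a\ge 0,\ p\in CX^\infty),$$ $$f^\infty((1-t)p+tq)\le (1-t)f^\infty(p)+t f^\infty(q)\qquad (p,q\in CX^\infty,\ t\in[0,1]),$$ where $(1-t)p+tq$ denotes the point $z$ on the geodesic of $CX^\infty$ from $p$ to $q$ with $d^\infty(p,z)=t\,d^\infty(p,q)$. -/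

import Mathlib

open Filter Topology
open scoped NNReal

noncomputable section

namespace Hadamard

/-- `γ`, restricted to `[0, l]`, is a geodesic path of length `l` from `x` to `y`
(values of `γ` outside `[0, l]` are irrelevant). -/
structure IsGeodesicPath {Y : Type*} [Dist Y] (γ : ℝ → Y) (l : ℝ) (x y : Y) : Prop where
  length_nonneg : 0 ≤ l
  source : γ 0 = x
  target : γ l = y
  dist_eq : ∀ s ∈ Set.Icc 0 l, ∀ t ∈ Set.Icc 0 l, dist (γ s) (γ t) = |s - t|

/-- Any two points are joined by a geodesic path. -/
def IsGeodesicSpace (Y : Type*) [Dist Y] : Prop :=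
  ∀ x y : Y, ∃ (γ : ℝ → Y) (l : ℝ), IsGeodesicPath γ l x y

/-- Any two points are joined by exactly one geodesic path. -/
def IsUniquelyGeodesic (Y : Type*) [Dist Y] : Prop :=
  IsGeodesicSpace Y ∧
    ∀ (x y : Y) (γ γ' : ℝ → Y) (l l' : ℝ),
      IsGeodesicPath γ l x y → IsGeodesicPath γ' l' x y → l = l' ∧ Set.EqOn γ γ' (Set.Icc 0 l)

/-- The CAT(0) inequality for all geodesic triangles: two points on the sides `[x, y]` and
`[x, z]` are at most as far apart as the corresponding points of a comparison triangle in the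
Euclidean plane. -/
def CAT0Inequality (X : Type*) [Dist X] : Prop :=
  ∀ (x y z : X) (c c' : ℝ → X),
    IsGeodesicPath c (dist x y) x y → IsGeodesicPath c' (dist x z) x z →
    ∀ x' y' z' : EuclideanSpace ℝ (Fin 2),
      dist x' y' = dist x y → dist y' z' = dist y z → dist z' x' = dist z x →
      ∀ t ∈ Set.Icc (0 : ℝ) 1, ∀ t' ∈ Set.Icc (0 : ℝ) 1,
        dist (c (t * dist x y)) (c' (t' * dist x z)) ≤
          dist ((1 - t) • x' + t • y') ((1 - t') • x' + t' • z')

/-- A Hadamard space: a complete CAT(0) geodesic metric space. -/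
structure IsHadamardSpace (X : Type*) [MetricSpace X] : Prop where
  complete : CompleteSpace X
  geodesic : IsGeodesicSpace X
  cat0 : CAT0Inequality X

/-- Convexity along geodesics of a function with values in `ℝ ∪ {∞}` (it is only applied to
functions avoiding `⊥`). Here `γ (t * l)` is the point `(1 - t) x + t y` of the geodesic `γ`
of length `l` from `x` to `y`, and `0 * ⊤ = 0`. -/
def IsGeodesicallyConvex {Y : Type*} [Dist Y] (F : Y → EReal) : Prop :=
  ∀ (x y : Y) (γ : ℝ → Y) (l : ℝ), IsGeodesicPath γ l x y →
    ∀ t ∈ Set.Icc (0 : ℝ) 1,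
      F (γ (t * l)) ≤ ((1 - t : ℝ) : EReal) * F x + ((t : ℝ) : EReal) * F y

variable {X : Type*} [MetricSpace X]

/-- A geodesic ray `[0, ∞) → X` (values at negative times are irrelevant). -/
structure GeodesicRay (X : Type*) [MetricSpace X] where
  toFun : ℝ → X
  dist_eq : ∀ s t : ℝ, 0 ≤ s → 0 ≤ t → dist (toFun s) (toFun t) = |s - t|

instance : CoeFun (GeodesicRay X) (fun _ => ℝ → X) := ⟨GeodesicRay.toFun⟩

/-- Two geodesic rays are asymptotic if they stay at bounded distance. -/
def Asymptotic (c c' : GeodesicRay X) : Prop :=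
  ∃ K : ℝ, 0 < K ∧ ∀ t : ℝ, 0 ≤ t → dist (c t) (c' t) ≤ K

instance asymptoticSetoid (X : Type*) [MetricSpace X] : Setoid (GeodesicRay X) where
  r := Asymptotic
  iseqv :=
    { refl := fun c => ⟨1, one_pos, fun t _ => by simp⟩
      symm := by
        rintro c c' ⟨K, hK, h⟩
        exact ⟨K, hK, fun t ht => by rw [dist_comm]; exact h t ht⟩
      trans := by
        rintro c₁ c₂ c₃ ⟨K, hK, h⟩ ⟨L, hL, h'⟩
        exact ⟨K + L, add_pos hK hL, fun t ht =>
          (dist_triangle _ (c₂ t) _).trans (add_le_add (h t ht) (h' t ht))⟩ }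

/-- The boundary at infinity: asymptotic classes of geodesic rays. -/
def Boundary (X : Type*) [MetricSpace X] : Type _ := Quotient (asymptoticSetoid X)

/-- The asymptotic class `c(∞)` of a geodesic ray. -/
def GeodesicRay.endpoint (c : GeodesicRay X) : Boundary X := Quotient.mk _ c

/-- The comparison angle at `x` between `y` and `z` (both different from `x`): the angle at the
vertex corresponding to `x` of a Euclidean triangle with the same side lengths, given by the law
of cosines. -/
def comparisonAngle (x y z : X) : ℝ :=
  Real.arccos ((dist x y ^ 2 + dist x z ^ 2 - dist y z ^ 2) / (2 * dist x y * dist x z))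

/-- The angle at the common starting point of two geodesic rays `c`, `c'`. -/
def rayAngle (c c' : GeodesicRay X) : ℝ :=
  limUnder (𝓝[>] (0 : ℝ)) (fun t => comparisonAngle (c 0) (c t) (c' t))

/-- The angular metric on the boundary: the supremum over all `x` of the angle at `x` of the
rays issuing from `x` in the two given classes. -/
def Boundary.angle (ξ ξ' : Boundary X) : ℝ :=
  sSup {θ : ℝ | ∃ (x : X) (c c' : GeodesicRay X), c 0 = x ∧ c' 0 = x ∧
    c.endpoint = ξ ∧ c'.endpoint = ξ' ∧ θ = rayAngle c c'}

/-- The relation on `[0, ∞) × X^∞` that collapses `{0} × X^∞` to a point. -/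
def coneSetoid (X : Type*) [MetricSpace X] : Setoid (ℝ≥0 × Boundary X) where
  r a b := (a.1 = 0 ∧ b.1 = 0) ∨ a = b
  iseqv :=
    { refl := fun _ => Or.inr rfl
      symm := by
        rintro a b (⟨h, h'⟩ | h)
        · exact Or.inl ⟨h', h⟩
        · exact Or.inr h.symm
      trans := by
        rintro a b c (⟨h₁, h₂⟩ | rfl) (⟨h₃, h₄⟩ | rfl)
        · exact Or.inl ⟨h₁, h₄⟩
        · exact Or.inl ⟨h₁, h₂⟩
        · exact Or.inl ⟨h₃, h₄⟩
        · exact Or.inr rfl }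

/-- The Euclidean cone `CX^∞` over the boundary at infinity. -/
def BoundaryCone (X : Type*) [MetricSpace X] : Type _ := Quotient (coneSetoid X)

namespace BoundaryCone

/-- The point `r ξ` of the cone. -/
def mk (r : ℝ≥0) (ξ : Boundary X) : BoundaryCone X := Quotient.mk (coneSetoid X) (r, ξ)

/-- Scaling: `a • (r ξ) = (a r) ξ`. -/
instance : SMul ℝ≥0 (BoundaryCone X) where
  smul a := Quotient.lift (fun u : ℝ≥0 × Boundary X => mk (a * u.1) u.2) (by
    rintro u v (⟨h, h'⟩ | rfl)
    · exact Quotient.sound (Or.inl ⟨by simp [h], by simp [h']⟩)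
    · rfl)

theorem smul_mk (a r : ℝ≥0) (ξ : Boundary X) : a • mk r ξ = mk (a * r) ξ := rfl

/-- The metric `d^∞(r ξ, r' ξ') = √(r² + r'² - 2 r r' cos ∠(ξ, ξ'))`. -/
instance : Dist (BoundaryCone X) where
  dist := Quotient.lift₂
    (fun u v : ℝ≥0 × Boundary X =>
      √((u.1 : ℝ) ^ 2 + (v.1 : ℝ) ^ 2 - 2 * u.1 * v.1 * Real.cos (Boundary.angle u.2 v.2))) (by
    rintro u v u' v' (⟨h₁, h₂⟩ | rfl) (⟨h₃, h₄⟩ | rfl) <;> simp [*])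

theorem dist_mk (r r' : ℝ≥0) (ξ ξ' : Boundary X) :
    dist (mk r ξ) (mk r' ξ') =
      √((r : ℝ) ^ 2 + (r' : ℝ) ^ 2 - 2 * r * r' * Real.cos (Boundary.angle ξ ξ')) := rfl

end BoundaryCone

/-- `γ` is (on `[0, ∞)`) the constant-speed ray `t ↦ c (r t)` for a geodesic ray `c` and
`r ≥ 0`, and its endpoint `γ(∞) = r c(∞)` is `p`. -/
def IsRayTo (γ : ℝ → X) (p : BoundaryCone X) : Prop :=
  ∃ (c : GeodesicRay X) (r : ℝ≥0),
    (∀ t : ℝ, 0 ≤ t → γ t = c (r * t)) ∧ BoundaryCone.mk r c.endpoint = p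

theorem exists_isRayTo (p : BoundaryCone X) : ∃ γ : ℝ → X, IsRayTo γ p := by
  induction p using Quotient.inductionOn with
  | h u =>
    obtain ⟨r, ξ⟩ := u
    induction ξ using Quotient.inductionOn with
    | h c => exact ⟨fun t => c (r * t), c, r, fun _ _ => rfl, rfl⟩

/-- The recession function `f^∞(p) = lim_{t → ∞} (f (c t) - f (c 0)) / t`, where `c` is some
constant-speed ray with `c(∞) = p`. -/
def recession (f : X → ℝ) (p : BoundaryCone X) : EReal :=
  let c : ℝ → X := (exists_isRayTo p).choose
  limUnder atTop (fun t : ℝ => (((f (c t) - f (c 0)) / t : ℝ) : EReal))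

/-- Positive homogeneity: `F (a p) = a F (p)` for all `a ≥ 0` (with `0 * ⊤ = 0`). -/
def IsPositivelyHomogeneous (F : BoundaryCone X → EReal) : Prop :=
  ∀ (a : ℝ≥0) (p : BoundaryCone X), F (a • p) = ((a : ℝ) : EReal) * F p

end Hadamard

end

namespace Hadamard

variable {X : Type*} [MetricSpace X]

/-! The cone metric is a growth rate: if `a`, `b` are constant-speed rays ending at `p`, `q`, then
`dist (a t) (b t) / t` tends to `dist p q` (`tendsto_dist_div`). Comparison angles are monotone, so
for rays from a common point the comparison angle has a limit as `t → ∞`, and `angle_eq` identifies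
that limit with the angular metric. The geometry of the cone can then be obtained from that of `X`
by dividing by `t`.

Given rays `a`, `b` from one point `x`, let `m t` divide the segment from `a t` to `b t` in a fixed
ratio. The segments from `x` to `m t` converge to a ray following `m` with error `o(t)`
(`exists_isRay_interpolate`); its endpoint is the required point `z` between `p` and `q`. The CAT(0)
inequality for the distance from `m t` to a third ray, divided by `t ^ 2`, becomes the same
inequality for `z` in the cone. This forces every geodesic from `p` to `q` to pass through `z`.

For convex `f`, slopes along a ray increase, hence have a limit. Convexity along the segment from
`x` to `m t` bounds an early slope by the slope at `m t`; convexity along the segment from `a t` to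
`b t` bounds that by the slopes along `a` and `b`; continuity of `f` passes the bound to the limit
ray. With `m` an asymptotic ray instead, the same argument gives independence of the ray. -/

/-! ### Segments and the CAT(0) inequality -/

/-- `σ`, restricted to `[0, 1]`, is a geodesic segment parametrized proportionally to length. -/
def IsSegment (σ : ℝ → X) : Prop :=
  ∀ s ∈ Set.Icc (0 : ℝ) 1, ∀ t ∈ Set.Icc (0 : ℝ) 1,
    dist (σ s) (σ t) = |s - t| * dist (σ 0) (σ 1)

theorem IsGeodesicPath.length_eq {Y : Type*} [Dist Y] {γ : ℝ → Y} {l : ℝ} {x y : Y}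
    (h : IsGeodesicPath γ l x y) : l = dist x y := by
  have := h.dist_eq 0 ⟨le_rfl, h.length_nonneg⟩ l ⟨h.length_nonneg, le_rfl⟩
  rw [h.source, h.target, zero_sub, abs_neg, abs_of_nonneg h.length_nonneg] at this
  exact this.symm

theorem IsGeodesicPath.isSegment {γ : ℝ → X} {l : ℝ} {x y : X}
    (h : IsGeodesicPath γ l x y) : IsSegment fun t => γ (t * l) := by
  intro s hs t ht
  have hl := h.length_nonneg
  simp only [zero_mul, one_mul, h.source, h.target, ← h.length_eq]
  rw [h.dist_eq _ ⟨mul_nonneg hs.1 hl, mul_le_of_le_one_left hl hs.2⟩ _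
    ⟨mul_nonneg ht.1 hl, mul_le_of_le_one_left hl ht.2⟩, ← sub_mul, abs_mul, abs_of_nonneg hl]

theorem IsSegment.isGeodesicPath {σ : ℝ → X} (h : IsSegment σ) :
    IsGeodesicPath (fun u => σ (u / dist (σ 0) (σ 1))) (dist (σ 0) (σ 1)) (σ 0) (σ 1) := by
  rcases eq_or_ne (dist (σ 0) (σ 1)) 0 with h0 | h0
  · refine ⟨dist_nonneg, by simp, ?_, ?_⟩
    · simp only [h0, div_zero]; exact dist_eq_zero.1 h0
    · intro s hs t ht
      rw [h0, Set.Icc_self, Set.mem_singleton_iff] at hs ht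
      simp [hs, ht]
  · have hp : 0 < dist (σ 0) (σ 1) := lt_of_le_of_ne dist_nonneg h0.symm
    refine ⟨dist_nonneg, by simp, by simp [div_self h0], ?_⟩
    intro s hs t ht
    rw [h _ ⟨div_nonneg hs.1 hp.le, (div_le_one hp).2 hs.2⟩ _
      ⟨div_nonneg ht.1 hp.le, (div_le_one hp).2 ht.2⟩, ← sub_div, abs_div, abs_of_pos hp]
    field_simp

theorem IsSegment.reparam {σ : ℝ → X} (h : IsSegment σ) {t : ℝ} (ht : t ∈ Set.Icc (0 : ℝ) 1) :
    σ (t * dist (σ 0) (σ 1) / dist (σ 0) (σ 1)) = σ t := by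
  rcases eq_or_ne (dist (σ 0) (σ 1)) 0 with h0 | h0
  · rw [h0, mul_zero, zero_div]
    have := h 0 ⟨le_rfl, zero_le_one⟩ t ht
    rwa [h0, mul_zero, dist_eq_zero] at this
  · rw [mul_div_cancel_right₀ _ h0]

theorem IsSegment.reverse {σ : ℝ → X} (h : IsSegment σ) : IsSegment fun t => σ (1 - t) := by
  intro s hs t ht
  simp only [sub_zero, sub_self]
  rw [h _ ⟨by linarith [hs.2], by linarith [hs.1]⟩ _ ⟨by linarith [ht.2], by linarith [ht.1]⟩,
    dist_comm (σ 1), abs_sub_comm]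
  ring_nf

/-- Every triple of distances in a metric space has a comparison triangle in the plane. -/
theorem exists_comparison_triangle (x y z : X) :
    ∃ y' z' : EuclideanSpace ℝ (Fin 2), ‖y'‖ = dist x y ∧ ‖z'‖ = dist x z ∧
      dist y' z' = dist y z := by
  set a := dist x y with ha
  set b := dist x z with hb
  set c := dist y z with hc
  have hac : a ≤ b + c := by
    have := dist_triangle x z y; rw [dist_comm z y] at this; exact this
  have hbc : b ≤ a + c := dist_triangle x y z
  have hcc : c ≤ a + b := by
    have := dist_triangle y x z; rw [dist_comm y x] at this; exact this
  have ha0 : 0 ≤ a := dist_nonneg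
  have hb0 : 0 ≤ b := dist_nonneg
  have hc0 : 0 ≤ c := dist_nonneg
  obtain ⟨u, v, h1, h2⟩ : ∃ u v : ℝ, u ^ 2 + v ^ 2 = b ^ 2 ∧ (a - u) ^ 2 + v ^ 2 = c ^ 2 := by
    rcases eq_or_lt_of_le ha0 with h0 | h0
    · refine ⟨b, 0, by ring, ?_⟩
      have : b = c := by linarith
      rw [← h0, this]; ring
    -- Law of cosines with one side on the first axis; the triangle inequalities make the radicand
    -- nonnegative.
    · refine ⟨(a ^ 2 + b ^ 2 - c ^ 2) / (2 * a),
        √(b ^ 2 - ((a ^ 2 + b ^ 2 - c ^ 2) / (2 * a)) ^ 2), ?_, ?_⟩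
      all_goals
        rw [Real.sq_sqrt]
        · field_simp
          ring
        · rw [sub_nonneg]
          apply sq_le_sq'
          · rw [le_div_iff₀ (by positivity)]; nlinarith
          · rw [div_le_iff₀ (by positivity)]; nlinarith
  refine ⟨!₂[a, 0], !₂[u, v], ?_, ?_, ?_⟩
  · simp [EuclideanSpace.norm_eq, Real.sqrt_sq ha0]
  · simp [EuclideanSpace.norm_eq, h1, Real.sqrt_sq hb0]
  · simp [EuclideanSpace.dist_eq, Real.dist_eq, h2, Real.sqrt_sq hc0]

/-- With the comparison triangle's vertex at the origin, the right side is `‖s • y' - t • z'‖ ^ 2`,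
its inner product expressed by the side lengths. Every later use of CAT(0) goes through this form.
-/
theorem IsHadamardSpace.dist_sq_le (hX : IsHadamardSpace X) {σ τ : ℝ → X}
    (hσ : IsSegment σ) (hτ : IsSegment τ) (h0 : σ 0 = τ 0) {s t : ℝ}
    (hs : s ∈ Set.Icc (0 : ℝ) 1) (ht : t ∈ Set.Icc (0 : ℝ) 1) :
    dist (σ s) (τ t) ^ 2 ≤ s ^ 2 * dist (σ 0) (σ 1) ^ 2 + t ^ 2 * dist (τ 0) (τ 1) ^ 2
      - s * t * (dist (σ 0) (σ 1) ^ 2 + dist (τ 0) (τ 1) ^ 2 - dist (σ 1) (τ 1) ^ 2) := by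
  obtain ⟨y', z', hy, hz, hyz⟩ := exists_comparison_triangle (σ 0) (σ 1) (τ 1)
  have hτ' := hτ.isGeodesicPath
  rw [← h0] at hτ'
  have key := hX.cat0 (σ 0) (σ 1) (τ 1) _ _ hσ.isGeodesicPath hτ' 0 y' z'
    (by rw [dist_zero_left, hy]) hyz (by rw [dist_zero_right, hz, dist_comm]) s hs t ht
  rw [hσ.reparam hs, h0, hτ.reparam ht, smul_zero, smul_zero, zero_add, zero_add] at key
  have h1 := pow_le_pow_left₀ dist_nonneg key 2
  refine h1.trans (le_of_eq ?_)
  rw [dist_eq_norm] at hyz ⊢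
  rw [← h0, ← hy, ← hz, ← hyz, norm_sub_sq_real, norm_sub_sq_real, norm_smul, norm_smul,
    inner_smul_left, inner_smul_right, mul_pow, mul_pow, Real.norm_eq_abs, Real.norm_eq_abs,
    sq_abs, sq_abs]
  simp only [conj_trivial]
  ring

theorem IsHadamardSpace.exists_isSegment (hX : IsHadamardSpace X) (x y : X) :
    ∃ σ : ℝ → X, IsSegment σ ∧ σ 0 = x ∧ σ 1 = y := by
  obtain ⟨γ, l, h⟩ := hX.geodesic x y
  exact ⟨_, h.isSegment, by simp [h.source], by simp [h.target]⟩

/-- The Bruhat–Tits inequality: the preceding lemma with the second point at the far end of its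
side. -/
theorem IsHadamardSpace.dist_sq_segment_le (hX : IsHadamardSpace X) {σ : ℝ → X}
    (hσ : IsSegment σ) (z : X) {t : ℝ} (ht : t ∈ Set.Icc (0 : ℝ) 1) :
    dist (σ t) z ^ 2 ≤ (1 - t) * dist (σ 0) z ^ 2 + t * dist (σ 1) z ^ 2
      - t * (1 - t) * dist (σ 0) (σ 1) ^ 2 := by
  obtain ⟨τ, hτ, h0, h1⟩ := hX.exists_isSegment (σ 0) z
  have := hX.dist_sq_le hσ hτ h0.symm ht (t := 1) ⟨zero_le_one, le_rfl⟩
  rw [h0, h1] at this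
  linarith

theorem IsHadamardSpace.dist_le_mul (hX : IsHadamardSpace X) {σ τ : ℝ → X}
    (hσ : IsSegment σ) (hτ : IsSegment τ) (h0 : σ 0 = τ 0) {s : ℝ}
    (hs : s ∈ Set.Icc (0 : ℝ) 1) : dist (σ s) (τ s) ≤ s * dist (σ 1) (τ 1) := by
  have := hX.dist_sq_le hσ hτ h0 hs hs
  refine abs_le_of_sq_le_sq' ?_ (mul_nonneg hs.1 dist_nonneg) |>.2
  linarith

theorem IsHadamardSpace.dist_le_one_sub_mul (hX : IsHadamardSpace X) {σ τ : ℝ → X}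
    (hσ : IsSegment σ) (hτ : IsSegment τ) (h1 : σ 1 = τ 1) {s : ℝ}
    (hs : s ∈ Set.Icc (0 : ℝ) 1) : dist (σ s) (τ s) ≤ (1 - s) * dist (σ 0) (τ 0) := by
  have := hX.dist_le_mul hσ.reverse hτ.reverse (by simpa using h1) (s := 1 - s)
    ⟨by linarith [hs.2], by linarith [hs.1]⟩
  simpa using this

theorem IsGeodesicallyConvex.segment_le {f : X → ℝ}
    (hf : IsGeodesicallyConvex (fun x => (f x : EReal))) {σ : ℝ → X} (hσ : IsSegment σ)
    {t : ℝ} (ht : t ∈ Set.Icc (0 : ℝ) 1) : f (σ t) ≤ (1 - t) * f (σ 0) + t * f (σ 1) := by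
  have := hf _ _ _ _ hσ.isGeodesicPath t ht
  simp only [hσ.reparam ht] at this
  exact_mod_cast this

/-! ### Constant-speed rays and their endpoints -/

/-- `ρ`, restricted to `[0, ∞)`, has constant speed `r` and is globally minimizing. -/
def IsRay (ρ : ℝ → X) (r : ℝ) : Prop :=
  ∀ s t : ℝ, 0 ≤ s → 0 ≤ t → dist (ρ s) (ρ t) = r * |s - t|

theorem IsRay.isSegment {ρ : ℝ → X} {r : ℝ} (h : IsRay ρ r) {a b : ℝ} (ha : 0 ≤ a) (hb : 0 ≤ b) :
    IsSegment fun t => ρ (a + t * (b - a)) := by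
  have key : ∀ t ∈ Set.Icc (0 : ℝ) 1, 0 ≤ a + t * (b - a) := fun t ht => by
    nlinarith [mul_nonneg (sub_nonneg.2 ht.2) ha, mul_nonneg ht.1 hb]
  intro s hs t ht
  simp only
  rw [h _ _ (key s hs) (key t ht), h _ _ (key 0 (by simp)) (key 1 (by simp))]
  rw [show a + s * (b - a) - (a + t * (b - a)) = (s - t) * (b - a) by ring, abs_mul,
    show a + 0 * (b - a) - (a + 1 * (b - a)) = -(b - a) by ring, abs_neg]
  ring

theorem IsRay.isSegment_zero {ρ : ℝ → X} {r : ℝ} (h : IsRay ρ r) {b : ℝ} (hb : 0 ≤ b) :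
    IsSegment fun t => ρ (t * b) := by
  simpa using h.isSegment le_rfl hb

theorem IsRay.speed_nonneg {ρ : ℝ → X} {r : ℝ} (h : IsRay ρ r) : 0 ≤ r := by
  have := h 0 1 le_rfl zero_le_one
  have h2 : (0 : ℝ) ≤ dist (ρ 0) (ρ 1) := dist_nonneg
  simpa [this] using h2

theorem GeodesicRay.isRay (c : GeodesicRay X) {r : ℝ} (hr : 0 ≤ r) :
    IsRay (fun t => c (r * t)) r := by
  intro s t hs ht
  simp only
  rw [c.dist_eq _ _ (mul_nonneg hr hs) (mul_nonneg hr ht), ← mul_sub, abs_mul, abs_of_nonneg hr]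

theorem GeodesicRay.isRay_one (c : GeodesicRay X) : IsRay c 1 := by
  simpa using c.isRay zero_le_one

theorem div_mem_Icc {s t : ℝ} (hs : 0 ≤ s) (hst : s ≤ t) : s / t ∈ Set.Icc (0 : ℝ) 1 :=
  ⟨div_nonneg hs (hs.trans hst), div_le_one_of_le₀ hst (hs.trans hst)⟩

theorem IsSegment.initial {σ : ℝ → X} (h : IsSegment σ) {k : ℝ} (hk : k ∈ Set.Icc (0 : ℝ) 1) :
    IsSegment fun v => σ (v * k) := by
  intro s hs t ht
  simp only
  rw [h _ ⟨mul_nonneg hs.1 hk.1, mul_le_one₀ hs.2 hk.1 hk.2⟩ _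
    ⟨mul_nonneg ht.1 hk.1, mul_le_one₀ ht.2 hk.1 hk.2⟩, zero_mul, one_mul,
    h 0 ⟨le_rfl, zero_le_one⟩ k hk, zero_sub, abs_neg, ← sub_mul, abs_mul]
  ring

/-- If the segments from `x` to `m t` pass, at time `s`, at distance `o(s)` from `m s`, uniformly
in `t ≥ s`, then they converge to a ray that follows `m` sublinearly. -/
theorem IsHadamardSpace.exists_limit_isRay (hX : IsHadamardSpace X) {x : X} {m : ℝ → X}
    {σ : ℝ → ℝ → X} {ε : ℝ → ℝ} (hσ : ∀ t, IsSegment (σ t)) (h0 : ∀ t, σ t 0 = x)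
    (h1 : ∀ t, σ t 1 = m t) (hε : Tendsto ε atTop (𝓝 0))
    (h : ∀ s t, 0 < s → s ≤ t → dist (σ t (s / t)) (m s) ≤ s * ε s) :
    ∃ (ρ : ℝ → X) (r : ℝ), IsRay ρ r ∧ ρ 0 = x ∧ (∀ s, 0 < s → dist (ρ s) (m s) ≤ s * ε s) ∧
      ∀ u, 0 ≤ u → Tendsto (fun t => σ t (u / t)) atTop (𝓝 (ρ u)) := by
  have := hX.complete
  -- At time `s` the two segments are `s * ε s` apart; both start at `x`, so at time `u` this
  -- shrinks by the factor `u / s`.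
  have close : ∀ u s t, 0 ≤ u → 0 < s → u ≤ s → s ≤ t →
      dist (σ t (u / t)) (σ s (u / s)) ≤ u * ε s := by
    intro u s t hu hs hus hst
    have := hX.dist_le_mul ((hσ t).initial (div_mem_Icc hs.le hst)) (hσ s)
      (by simp [h0]) (div_mem_Icc hu hus)
    simp only [one_mul, h1] at this
    rw [div_mul_div_cancel₀ hs.ne'] at this
    refine this.trans ((mul_le_mul_of_nonneg_left (h s t hs hst)
      (div_nonneg hu hs.le)).trans (le_of_eq ?_))
    field_simp
  have cauchy : ∀ u, 0 ≤ u → CauchySeq fun t => σ t (u / t) := by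
    intro u hu
    rw [Metric.cauchySeq_iff']
    intro δ hδ
    have hlim : Tendsto (fun s => u * ε s) atTop (𝓝 0) := by simpa using hε.const_mul u
    obtain ⟨N, hN, hN1, hN2⟩ := ((hlim.eventually_lt_const hδ).and
      ((eventually_ge_atTop u).and (eventually_gt_atTop 0))).exists
    exact ⟨N, fun t ht => (close u N t hu hN2 hN1 ht).trans_lt hN⟩
  have lim : ∀ u, ∃ y, 0 ≤ u → Tendsto (fun t => σ t (u / t)) atTop (𝓝 y) := by
    intro u
    by_cases hu : 0 ≤ u
    · obtain ⟨y, hy⟩ := cauchySeq_tendsto_of_complete (cauchy u hu)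
      exact ⟨y, fun _ => hy⟩
    · exact ⟨x, fun h => absurd h hu⟩
  choose ρ hρ using lim
  -- The case `u = 1`, `v = 0` shows that `dist x (m t) / t` converges; its limit is the speed.
  have hd : ∀ u v, 0 ≤ u → 0 ≤ v →
      Tendsto (fun t => |u - v| * (dist x (m t) / t)) atTop (𝓝 (dist (ρ u) (ρ v))) := by
    intro u v hu hv
    refine ((hρ u hu).dist (hρ v hv)).congr' ?_
    filter_upwards [eventually_ge_atTop u, eventually_ge_atTop v, eventually_gt_atTop 0]
      with t htu htv ht
    rw [hσ t _ (div_mem_Icc hu htu) _ (div_mem_Icc hv htv), h0, h1, ← sub_div, abs_div,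
      abs_of_pos ht]
    ring
  refine ⟨ρ, dist (ρ 1) (ρ 0), ?_, ?_, ?_, hρ⟩
  · intro u v hu hv
    have := hd 1 0 zero_le_one le_rfl
    simp only [sub_zero, abs_one, one_mul] at this
    rw [mul_comm]
    exact tendsto_nhds_unique (hd u v hu hv) (this.const_mul _)
  · refine tendsto_nhds_unique (hρ 0 le_rfl) ?_
    simp [h0]
  · intro s hs
    refine le_of_tendsto ((hρ s hs.le).dist tendsto_const_nhds) ?_
    filter_upwards [eventually_ge_atTop s] with t ht using h s t hs ht

theorem IsRay.speed_eq {a b : ℝ → X} {r r' K : ℝ} (ha : IsRay a r) (hb : IsRay b r')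
    (h : ∀ t, 0 ≤ t → dist (a t) (b t) ≤ K) : r = r' := by
  have key : ∀ t, 0 < t → |r - r'| ≤ 2 * K / t := by
    intro t ht
    rw [le_div_iff₀ ht]
    have h1 := ha 0 t le_rfl ht.le
    have h2 := hb 0 t le_rfl ht.le
    have h3 := dist_dist_dist_le (a 0) (a t) (b 0) (b t)
    rw [Real.dist_eq, h1, h2, ← sub_mul, abs_mul, abs_abs, zero_sub, abs_neg, abs_of_pos ht] at h3
    linarith [h 0 le_rfl, h t ht.le]
  have hlim : Tendsto (fun t : ℝ => 2 * K / t) atTop (𝓝 0) :=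
    tendsto_const_nhds.div_atTop tendsto_id
  have := ge_of_tendsto hlim ((eventually_gt_atTop 0).mono key)
  exact sub_eq_zero.1 (abs_nonpos_iff.1 this)

/-- Take `m = a` in the limit construction. There `s * ε s` is the constant `dist x (a 0)`, so
sublinear closeness becomes bounded distance. -/
theorem IsHadamardSpace.exists_isRay_from (hX : IsHadamardSpace X) {a : ℝ → X} {r : ℝ}
    (ha : IsRay a r) (x : X) :
    ∃ ρ : ℝ → X, IsRay ρ r ∧ ρ 0 = x ∧ ∃ K, ∀ t, 0 ≤ t → dist (ρ t) (a t) ≤ K := by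
  choose σ hσ h0 h1 using fun t => hX.exists_isSegment x (a t)
  obtain ⟨ρ, r', hρ, hρ0, hd, -⟩ := hX.exists_limit_isRay (ε := fun s => dist x (a 0) / s) hσ h0 h1
    (tendsto_const_nhds.div_atTop tendsto_id) (by
      intro s t hs hst
      have ht := hs.trans_le hst
      have := hX.dist_le_one_sub_mul (hσ t) (ha.isSegment_zero ht.le)
        (by simp [h1]) (div_mem_Icc hs.le hst)
      rw [div_mul_cancel₀ _ ht.ne', h0, zero_mul] at this
      rw [mul_div_cancel₀ _ hs.ne']
      refine this.trans (mul_le_of_le_one_left dist_nonneg ?_)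
      linarith [(div_mem_Icc hs.le hst).1])
  have hK : ∀ t, 0 ≤ t → dist (ρ t) (a t) ≤ dist x (a 0) := by
    intro t ht
    rcases ht.eq_or_lt with rfl | ht
    · rw [hρ0]
    · refine (hd t ht).trans (le_of_eq ?_)
      field_simp
  obtain rfl := hρ.speed_eq ha hK
  exact ⟨ρ, hρ, hρ0, _, hK⟩

theorem IsRayTo.exists_isRay {γ : ℝ → X} {p : BoundaryCone X} (h : IsRayTo γ p) :
    ∃ r, IsRay γ r := by
  obtain ⟨c, r, hγ, -⟩ := h
  refine ⟨r, fun s t hs ht => ?_⟩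
  rw [hγ s hs, hγ t ht]
  exact c.isRay r.2 s t hs ht

theorem IsRayTo.exists_dist_le {γ γ' : ℝ → X} {p : BoundaryCone X} (h : IsRayTo γ p)
    (h' : IsRayTo γ' p) : ∃ K, ∀ t, 0 ≤ t → dist (γ t) (γ' t) ≤ K := by
  obtain ⟨c, r, hγ, hp⟩ := h
  obtain ⟨c', r', hγ', hp'⟩ := h'
  rcases Quotient.exact (hp.trans hp'.symm) with ⟨h0, h0'⟩ | h
  · simp only at h0 h0'
    refine ⟨dist (c 0) (c' 0), fun t ht => ?_⟩
    rw [hγ t ht, hγ' t ht, h0, h0', NNReal.coe_zero, zero_mul]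
  · obtain ⟨rfl, h⟩ := Prod.ext_iff.1 h
    obtain ⟨K, -, hK⟩ := Quotient.exact h
    refine ⟨K, fun t ht => ?_⟩
    rw [hγ t ht, hγ' t ht]
    exact hK _ (mul_nonneg r.2 ht)

theorem IsHadamardSpace.isRayTo_of_dist_le (hX : IsHadamardSpace X) {γ γ' : ℝ → X}
    {p : BoundaryCone X} {r' K : ℝ} (h : IsRayTo γ p) (h' : IsRay γ' r')
    (hK : ∀ t, 0 ≤ t → dist (γ' t) (γ t) ≤ K) : IsRayTo γ' p := by
  obtain ⟨c, s, hγ, hp⟩ := id h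
  have hs : r' = s := by
    refine h'.speed_eq (c.isRay s.2) (K := K) fun t ht => ?_
    simpa only [← hγ t ht] using hK t ht
  subst hs
  rcases eq_or_ne s 0 with rfl | hs
  -- At speed zero only the starting point of the geodesic ray matters, since all `0 ξ` coincide.
  · obtain ⟨ρ, hρ, hρ0, L, hL⟩ := hX.exists_isRay_from c.isRay_one (γ' 0)
    refine ⟨⟨ρ, by simpa [IsRay] using hρ⟩, 0, fun t ht => ?_, ?_⟩
    · have := h' t 0 ht le_rfl
      simpa [hρ0] using this
    · rw [← hp]
      exact Quotient.sound (Or.inl ⟨rfl, rfl⟩)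
  · have hs0 : (0 : ℝ) < s := lt_of_le_of_ne s.2 (by exact_mod_cast hs.symm)
    refine ⟨⟨fun t => γ' (t / s), fun u v hu hv => ?_⟩, s, fun t ht => ?_, ?_⟩
    · rw [h' _ _ (div_nonneg hu hs0.le) (div_nonneg hv hs0.le), ← sub_div, abs_div,
        abs_of_pos hs0, mul_div_cancel₀ _ hs0.ne']
    · simp only
      rw [mul_div_cancel_left₀ _ hs0.ne']
    · rw [← hp]
      congr 1
      refine Quotient.sound ⟨max K 1, by positivity, fun t ht => ?_⟩
      have := hK (t / s) (div_nonneg ht hs0.le)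
      rw [hγ _ (div_nonneg ht hs0.le), mul_div_cancel₀ _ hs0.ne'] at this
      exact this.trans (le_max_left _ _)

theorem IsHadamardSpace.exists_isRayTo_from (hX : IsHadamardSpace X) (p : BoundaryCone X)
    (x : X) : ∃ ρ : ℝ → X, IsRayTo ρ p ∧ ρ 0 = x := by
  obtain ⟨γ, hγ⟩ := exists_isRayTo p
  obtain ⟨r, hr⟩ := hγ.exists_isRay
  obtain ⟨ρ, hρ, h0, K, hK⟩ := hX.exists_isRay_from hr x
  exact ⟨ρ, hX.isRayTo_of_dist_le hγ hρ hK, h0⟩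

theorem GeodesicRay.isRayTo (c : GeodesicRay X) (r : ℝ≥0) :
    IsRayTo (fun t => c (r * t)) (BoundaryCone.mk r c.endpoint) :=
  ⟨c, r, fun _ _ => rfl, rfl⟩

/-- The point `ξ` only witnesses that the boundary is nonempty: over an empty boundary the cone is
empty, and a constant ray has no endpoint. -/
theorem IsHadamardSpace.exists_endpoint (hX : IsHadamardSpace X) (ξ : Boundary X) {ρ : ℝ → X}
    {r : ℝ} (hρ : IsRay ρ r) : ∃ p, IsRayTo ρ p := by
  lift r to ℝ≥0 using hρ.speed_nonneg
  rcases eq_or_ne r 0 with rfl | hr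
  · induction ξ using Quotient.inductionOn with
    | h c =>
      refine ⟨BoundaryCone.mk 0 c.endpoint, hX.isRayTo_of_dist_le (c.isRayTo 0) hρ
        (K := dist (ρ 0) (c 0)) fun t ht => ?_⟩
      have := hρ t 0 ht le_rfl
      rw [NNReal.coe_zero, zero_mul, dist_eq_zero] at this
      simp [this]
  · have hr0 : (0 : ℝ) < r := lt_of_le_of_ne r.2 (by exact_mod_cast hr.symm)
    refine ⟨_, ⟨fun t => ρ (t / r), fun u v hu hv => ?_⟩, r, fun t ht => ?_, rfl⟩
    · rw [hρ _ _ (div_nonneg hu hr0.le) (div_nonneg hv hr0.le), ← sub_div, abs_div,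
        abs_of_pos hr0, mul_div_cancel₀ _ hr0.ne']
    · simp only
      rw [mul_div_cancel_left₀ _ hr0.ne']

/-! ### Comparison angles and the angular metric -/

/-- The cosine of the comparison angle at the common starting point of two rays between the points
at times `s` and `t`. -/
noncomputable def comparisonCos (c c' : GeodesicRay X) (s t : ℝ) : ℝ :=
  (s ^ 2 + t ^ 2 - dist (c s) (c' t) ^ 2) / (2 * s * t)

theorem GeodesicRay.dist_zero (c : GeodesicRay X) {t : ℝ} (ht : 0 ≤ t) : dist (c 0) (c t) = t := by
  rw [c.dist_eq 0 t le_rfl ht, zero_sub, abs_neg, abs_of_nonneg ht]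

theorem comparisonAngle_eq {c c' : GeodesicRay X} (h : c 0 = c' 0) {t : ℝ} (ht : 0 ≤ t) :
    comparisonAngle (c 0) (c t) (c' t) = Real.arccos (comparisonCos c c' t t) := by
  rw [comparisonAngle, c.dist_zero ht, h, c'.dist_zero ht, comparisonCos]

theorem dist_sq_eq_comparisonCos (c c' : GeodesicRay X) {s t : ℝ} (hs : 0 < s) (ht : 0 < t) :
    dist (c s) (c' t) ^ 2 = s ^ 2 + t ^ 2 - 2 * s * t * comparisonCos c c' s t := by
  rw [comparisonCos]
  field_simp
  ring

theorem comparisonCos_self_eq (c c' : GeodesicRay X) {t : ℝ} (ht : 0 < t) :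
    comparisonCos c c' t t = 1 - (dist (c t) (c' t) / t) ^ 2 / 2 := by
  rw [comparisonCos]
  field_simp
  ring

theorem comparisonCos_mem_Icc {c c' : GeodesicRay X} (h : c 0 = c' 0) {t : ℝ} (ht : 0 < t) :
    comparisonCos c c' t t ∈ Set.Icc (-1 : ℝ) 1 := by
  rw [comparisonCos_self_eq c c' ht]
  have h1 : dist (c t) (c' t) / t ≤ 2 := by
    rw [div_le_iff₀ ht]
    have := dist_triangle_left (c t) (c' t) (c 0)
    rw [c.dist_zero ht.le, h, c'.dist_zero ht.le] at this
    linarith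
  have h2 : 0 ≤ dist (c t) (c' t) / t := by positivity
  constructor <;> nlinarith

/-- CAT(0) as monotonicity of the comparison angle in both times independently. -/
theorem IsHadamardSpace.comparisonCos_le (hX : IsHadamardSpace X) {c c' : GeodesicRay X}
    (h : c 0 = c' 0) {s t S T : ℝ} (hs : 0 < s) (ht : 0 < t) (hsS : s ≤ S) (htT : t ≤ T) :
    comparisonCos c c' S T ≤ comparisonCos c c' s t := by
  have hS := hs.trans_le hsS
  have hT := ht.trans_le htT
  have key := hX.dist_sq_le (c.isRay_one.isSegment_zero hS.le) (c'.isRay_one.isSegment_zero hT.le)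
    (by simpa using h) (div_mem_Icc hs.le hsS) (div_mem_Icc ht.le htT)
  simp only [zero_mul, one_mul] at key
  rw [div_mul_cancel₀ _ hS.ne', div_mul_cancel₀ _ hT.ne', c.dist_zero hS.le, c'.dist_zero hT.le,
    dist_sq_eq_comparisonCos c c' hs ht, dist_sq_eq_comparisonCos c c' hS hT] at key
  have e : s / S * (t / T) * (S ^ 2 + T ^ 2 - (S ^ 2 + T ^ 2 - 2 * S * T * comparisonCos c c' S T))
      = 2 * s * t * comparisonCos c c' S T := by
    field_simp
    ring
  have e1 : (s / S) ^ 2 * S ^ 2 = s ^ 2 := by field_simp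
  have e2 : (t / T) ^ 2 * T ^ 2 = t ^ 2 := by field_simp
  rw [e, e1, e2] at key
  have hst : 0 < 2 * s * t := by positivity
  exact le_of_mul_le_mul_left (by linarith) hst

theorem tendsto_dist_div_congr {a b a' b' : ℝ → X} {D : ℝ}
    (h : Tendsto (fun t => dist (a t) (b t) / t) atTop (𝓝 D))
    (ha : Tendsto (fun t => dist (a t) (a' t) / t) atTop (𝓝 0))
    (hb : Tendsto (fun t => dist (b t) (b' t) / t) atTop (𝓝 0)) :
    Tendsto (fun t => dist (a' t) (b' t) / t) atTop (𝓝 D) := by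
  have h0 : Tendsto (fun t => dist (a' t) (b' t) / t - dist (a t) (b t) / t) atTop (𝓝 0) := by
    refine squeeze_zero_norm' ?_ (by simpa using ha.add hb)
    filter_upwards [eventually_gt_atTop 0] with t ht
    rw [← sub_div, Real.norm_eq_abs, abs_div, abs_of_pos ht, ← add_div]
    gcongr
    have := dist_dist_dist_le (a' t) (b' t) (a t) (b t)
    rwa [Real.dist_eq, dist_comm (a' t) (a t), dist_comm (b' t) (b t)] at this
  simpa using h0.add h

theorem tendsto_dist_div_zero {a b : ℝ → X} {K : ℝ} (h : ∀ t, 0 ≤ t → dist (a t) (b t) ≤ K) :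
    Tendsto (fun t => dist (a t) (b t) / t) atTop (𝓝 0) := by
  refine squeeze_zero' ?_ ?_
    (tendsto_const_nhds.div_atTop tendsto_id : Tendsto (fun t : ℝ => K / t) atTop (𝓝 0))
  all_goals filter_upwards [eventually_ge_atTop 0] with t ht
  · positivity
  · exact div_le_div_of_nonneg_right (h t ht) ht

theorem IsHadamardSpace.exists_tendsto_comparisonCos (hX : IsHadamardSpace X)
    {c c' : GeodesicRay X} (h : c 0 = c' 0) :
    ∃ κ ∈ Set.Icc (-1 : ℝ) 1, Tendsto (fun t => comparisonCos c c' t t) atTop (𝓝 κ) ∧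
      ∀ t, 0 < t → κ ≤ comparisonCos c c' t t := by
  have anti : Antitone fun t => comparisonCos c c' (max t 1) (max t 1) := fun s t hst =>
    hX.comparisonCos_le h (by positivity) (by positivity) (max_le_max_right _ hst)
      (max_le_max_right _ hst)
  have bdd : BddBelow (Set.range fun t => comparisonCos c c' (max t 1) (max t 1)) := by
    refine ⟨-1, ?_⟩
    rintro _ ⟨t, rfl⟩
    exact (comparisonCos_mem_Icc h (by positivity)).1
  have lim : Tendsto (fun t => comparisonCos c c' t t) atTop
      (𝓝 (⨅ t, comparisonCos c c' (max t 1) (max t 1))) := by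
    refine (tendsto_atTop_ciInf anti bdd).congr' ?_
    filter_upwards [eventually_ge_atTop 1] with t ht
    rw [max_eq_left ht]
  refine ⟨_, isClosed_Icc.mem_of_tendsto lim ?_, lim, fun t ht => le_of_tendsto lim ?_⟩
  · filter_upwards [eventually_gt_atTop 0] with t ht using comparisonCos_mem_Icc h ht
  · filter_upwards [eventually_ge_atTop t] with s hs using hX.comparisonCos_le h ht ht hs hs

theorem tendsto_dist_div_of_comparisonCos {c c' : GeodesicRay X} {κ : ℝ}
    (h : Tendsto (fun t => comparisonCos c c' t t) atTop (𝓝 κ)) :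
    Tendsto (fun t => dist (c t) (c' t) / t) atTop (𝓝 √(2 * (1 - κ))) := by
  refine (((h.const_sub 1).const_mul 2).sqrt).congr' ?_
  filter_upwards [eventually_gt_atTop 0] with t ht
  rw [comparisonCos_self_eq c c' ht, show 2 * (1 - (1 - (dist (c t) (c' t) / t) ^ 2 / 2)) =
    (dist (c t) (c' t) / t) ^ 2 by ring, Real.sqrt_sq (by positivity)]

theorem tendsto_comparisonCos_of_dist_div {c c' : GeodesicRay X} {D : ℝ}
    (h : Tendsto (fun t => dist (c t) (c' t) / t) atTop (𝓝 D)) :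
    Tendsto (fun t => comparisonCos c c' t t) atTop (𝓝 (1 - D ^ 2 / 2)) := by
  refine (((h.pow 2).div_const 2).const_sub 1).congr' ?_
  filter_upwards [eventually_gt_atTop 0] with t ht
  rw [comparisonCos_self_eq c c' ht]

/-- The limit `κ` and the growth rate `√(2 * (1 - κ))` determine each other, and bounded
perturbations do not change the growth rate. Hence `d` and `d'` need not start at the same point. -/
theorem tendsto_comparisonCos_asymptotic {c c' d d' : GeodesicRay X} {κ : ℝ}
    (hc : c.endpoint = d.endpoint)
    (hc' : c'.endpoint = d'.endpoint) (h : c 0 = c' 0)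
    (hκ : Tendsto (fun t => comparisonCos c c' t t) atTop (𝓝 κ)) :
    Tendsto (fun t => comparisonCos d d' t t) atTop (𝓝 κ) := by
  obtain ⟨K, -, hK⟩ := Quotient.exact hc
  obtain ⟨L, -, hL⟩ := Quotient.exact hc'
  have hκ1 : κ ≤ 1 := le_of_tendsto hκ <| by
    filter_upwards [eventually_gt_atTop 0] with t ht using (comparisonCos_mem_Icc h ht).2
  have := tendsto_comparisonCos_of_dist_div
    (tendsto_dist_div_congr (tendsto_dist_div_of_comparisonCos hκ)
      (tendsto_dist_div_zero hK) (tendsto_dist_div_zero hL))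
  rwa [Real.sq_sqrt (by linarith), mul_div_cancel_left₀ _ two_ne_zero, sub_sub_cancel] at this

theorem IsHadamardSpace.tendsto_rayAngle (hX : IsHadamardSpace X) {c c' : GeodesicRay X}
    (h : c 0 = c' 0) :
    Tendsto (fun t => Real.arccos (comparisonCos c c' t t)) (𝓝[>] 0) (𝓝 (rayAngle c c')) := by
  have mono : MonotoneOn (fun t => Real.arccos (comparisonCos c c' t t)) (Set.Ioi 0) :=
    fun s hs t _ hst => Real.antitone_arccos (hX.comparisonCos_le h hs hs hst hst)
  have lim := mono.tendsto_nhdsGT ⟨0, by rintro _ ⟨t, -, rfl⟩; exact Real.arccos_nonneg _⟩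
  have : rayAngle c c' = _ := Tendsto.limUnder_eq (lim.congr' (by
    filter_upwards [self_mem_nhdsWithin] with t ht
    exact (comparisonAngle_eq h (le_of_lt ht)).symm))
  rwa [this]

theorem IsHadamardSpace.rayAngle_le (hX : IsHadamardSpace X) {c c' : GeodesicRay X}
    (h : c 0 = c' 0) {t : ℝ} (ht : 0 < t) :
    rayAngle c c' ≤ Real.arccos (comparisonCos c c' t t) := by
  refine le_of_tendsto (hX.tendsto_rayAngle h) ?_
  filter_upwards [Ioo_mem_nhdsGT ht] with s hs
  exact Real.antitone_arccos (hX.comparisonCos_le h hs.1 hs.1 hs.2.le hs.2.le)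

/-- The ray `c` started at time `T`. -/
def GeodesicRay.shift (c : GeodesicRay X) {T : ℝ} (hT : 0 ≤ T) : GeodesicRay X where
  toFun t := c (T + t)
  dist_eq s t hs ht := by
    rw [c.dist_eq _ _ (add_nonneg hT hs) (add_nonneg hT ht), add_sub_add_left_eq_sub]

theorem GeodesicRay.endpoint_shift (c : GeodesicRay X) {T : ℝ} (hT : 0 ≤ T) :
    (c.shift hT).endpoint = c.endpoint := by
  refine Quotient.sound ⟨T + 1, by linarith, fun t ht => ?_⟩
  simp only [shift]
  rw [c.dist_eq _ _ (add_nonneg hT ht) ht, add_sub_cancel_right, abs_of_nonneg hT]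
  linarith

theorem IsHadamardSpace.exists_geodesicRay (hX : IsHadamardSpace X) (c : GeodesicRay X) (x : X) :
    ∃ d : GeodesicRay X, d 0 = x ∧ d.endpoint = c.endpoint := by
  obtain ⟨ρ, hρ, h0, K, hK⟩ := hX.exists_isRay_from c.isRay_one x
  refine ⟨⟨ρ, by simpa [IsRay] using hρ⟩, h0, Quotient.sound ⟨max K 1, by positivity, fun t ht =>
    (hK t ht).trans (le_max_left _ _)⟩⟩

/-- Along a ray `c`, the comparison angle with an asymptotic direction `c'(∞)` is at least the
comparison angle at the starting point. -/
theorem IsHadamardSpace.comparisonCos_shift_le (hX : IsHadamardSpace X) {c c' d : GeodesicRay X}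
    (h : c 0 = c' 0) {T : ℝ} (hT : 0 < T) (hd0 : d 0 = c T) (hd : d.endpoint = c'.endpoint)
    {ε : ℝ} (hε : 0 < ε) (hεT : ε ≤ T) :
    comparisonCos (c.shift hT.le) d ε ε ≤ comparisonCos c c' T T := by
  obtain ⟨K, -, hK⟩ := Quotient.exact hd
  choose σ hσ h0 h1 using fun s => hX.exists_isSegment (c T) (c' s)
  -- the points at distance about `ε` on the segments from `c T` to `c' s` converge to `d ε`
  have lim : Tendsto (fun s => σ s (ε / s)) atTop (𝓝 (d ε)) := by
    rw [tendsto_iff_dist_tendsto_zero]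
    refine squeeze_zero' (Eventually.of_forall fun _ => dist_nonneg) ?_
      (tendsto_const_nhds.div_atTop tendsto_id : Tendsto (fun s : ℝ => ε * K / s) atTop (𝓝 0))
    filter_upwards [eventually_ge_atTop ε] with s hs
    have hs0 := hε.trans_le hs
    have := hX.dist_le_mul (hσ s) (d.isRay_one.isSegment_zero hs0.le) (by simp [h0, hd0])
      (div_mem_Icc hε.le hs)
    simp only [one_mul] at this
    rw [h1, div_mul_cancel₀ _ hs0.ne', dist_comm (c' s)] at this
    refine this.trans ?_
    rw [mul_div_right_comm]
    exact mul_le_mul_of_nonneg_left (hK s hs0.le) (by positivity)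
  -- CAT(0) at the vertex `c T` of the triangle `c 0`, `c T`, `c' s`. As `s → ∞` the bound says that
  -- the angle there is at most `π` minus the comparison angle at `c 0` for times `T`, `T`.
  have bound : ∀ s, T ≤ s → dist (c (T - ε)) (σ s (ε / s)) ^ 2 ≤
      ε ^ 2 + ε ^ 2 * (1 + T / s) ^ 2 - 2 * ε ^ 2 * (T / s)
        + 2 * ε ^ 2 * comparisonCos c c' T T := by
    intro s hs
    have hs0 := hT.trans_le hs
    have key := hX.dist_sq_le (c.isRay_one.isSegment hT.le le_rfl) (hσ s) (by simp [h0])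
      (div_mem_Icc hε.le hεT) (div_mem_Icc hε.le (hεT.trans hs))
    simp only [zero_mul, add_zero, zero_sub, one_mul, add_neg_cancel] at key
    rw [h0, h1, mul_neg, div_mul_cancel₀ _ hT.ne', ← sub_eq_add_neg, dist_comm (c T) (c 0),
      c.dist_zero hT.le, h, c'.dist_zero hs0.le] at key
    have hL : dist (c T) (c' s) ≤ T + s := by
      have := dist_triangle_left (c T) (c' s) (c 0)
      rwa [c.dist_zero hT.le, h, c'.dist_zero hs0.le] at this
    have hL2 : dist (c T) (c' s) ^ 2 ≤ (T + s) ^ 2 := pow_le_pow_left₀ dist_nonneg hL 2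
    have hcos := hX.comparisonCos_le h hT hT le_rfl hs
    have e := dist_sq_eq_comparisonCos c c' hT hs0
    have e1 : (ε / T) ^ 2 * T ^ 2 = ε ^ 2 := by field_simp
    have e2 : (ε / s) ^ 2 * dist (c T) (c' s) ^ 2 ≤ ε ^ 2 * (1 + T / s) ^ 2 := by
      have : ε ^ 2 * (1 + T / s) ^ 2 = (ε / s) ^ 2 * (T + s) ^ 2 := by
        field_simp
        ring
      rw [this]
      gcongr
    have e3 : ε / T * (ε / s) * (T ^ 2 + dist (c T) (c' s) ^ 2 - s ^ 2) =
        2 * ε ^ 2 * (T / s) - 2 * ε ^ 2 * comparisonCos c c' T s := by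
      rw [e]
      field_simp
      ring
    rw [e1, e3] at key
    have : 2 * ε ^ 2 * comparisonCos c c' T s ≤ 2 * ε ^ 2 * comparisonCos c c' T T := by gcongr
    linarith
  have back : dist (c (T - ε)) (d ε) ^ 2 ≤ 2 * ε ^ 2 + 2 * ε ^ 2 * comparisonCos c c' T T := by
    have hT0 : Tendsto (fun s : ℝ => T / s) atTop (𝓝 0) :=
      tendsto_const_nhds.div_atTop tendsto_id
    have hr : Tendsto (fun s : ℝ => ε ^ 2 + ε ^ 2 * (1 + T / s) ^ 2 - 2 * ε ^ 2 * (T / s)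
        + 2 * ε ^ 2 * comparisonCos c c' T T) atTop
        (𝓝 (ε ^ 2 + ε ^ 2 * (1 + 0) ^ 2 - 2 * ε ^ 2 * 0 + 2 * ε ^ 2 * comparisonCos c c' T T)) :=
      ((tendsto_const_nhds.add (((hT0.const_add 1).pow 2).const_mul _)).sub
        (hT0.const_mul _)).add tendsto_const_nhds
    have := le_of_tendsto_of_tendsto ((tendsto_const_nhds.dist lim).pow 2) hr
      ((eventually_ge_atTop T).mono bound)
    linarith
  -- `c T` is the midpoint of `c (T - ε)` and `c (T + ε)`, so an upper bound on the distance from `d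
  -- ε` to the former gives a lower bound for the latter.
  have mid := hX.dist_sq_segment_le
    (c.isRay_one.isSegment (sub_nonneg.2 hεT) (b := T + ε) (by positivity)) (d ε) (t := 1 / 2)
    ⟨by norm_num, by norm_num⟩
  rw [show T - ε + 1 / 2 * (T + ε - (T - ε)) = T by ring,
    show T - ε + 1 * (T + ε - (T - ε)) = T + ε by ring,
    show T - ε + 0 * (T + ε - (T - ε)) = T - ε by ring,
    c.dist_eq _ _ (sub_nonneg.2 hεT) (by positivity), ← hd0, d.dist_zero hε.le, sq_abs] at mid
  have e := dist_sq_eq_comparisonCos (c.shift hT.le) d hε hε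
  simp only [GeodesicRay.shift] at e ⊢
  rw [e] at mid
  have : 0 < 2 * ε ^ 2 := by positivity
  refine le_of_mul_le_mul_left ?_ this
  nlinarith

/-- Upper bound: an angle at any point is at most the comparison angles there, which tend to `arccos
κ` whatever the base point. Lower bound: the angle at `c T` is at least the comparison angle at `c
0` for time `T`, so moving out along `c` exhausts `arccos κ`. -/
theorem IsHadamardSpace.angle_eq (hX : IsHadamardSpace X) {c c' : GeodesicRay X}
    (h : c 0 = c' 0) {κ : ℝ} (hκ : Tendsto (fun t => comparisonCos c c' t t) atTop (𝓝 κ)) :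
    Boundary.angle c.endpoint c'.endpoint = Real.arccos κ := by
  refine IsLUB.csSup_eq ⟨?_, ?_⟩ ⟨_, c 0, c, c', rfl, h.symm, rfl, rfl, rfl⟩
  · rintro _ ⟨x, d, d', h0, h0', hd, hd', rfl⟩
    refine ge_of_tendsto ((Real.continuous_arccos.tendsto _).comp
      (tendsto_comparisonCos_asymptotic hd.symm hd'.symm h hκ)) ?_
    filter_upwards [eventually_gt_atTop 0] with t ht using hX.rayAngle_le (h0.trans h0'.symm) ht
  · intro θ hθ
    refine le_of_tendsto ((Real.continuous_arccos.tendsto _).comp hκ) ?_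
    filter_upwards [eventually_gt_atTop 0] with T hT
    obtain ⟨d, hd0, hd⟩ := hX.exists_geodesicRay c' (c T)
    have h0 : c.shift hT.le 0 = d 0 := by simp [GeodesicRay.shift, hd0]
    refine le_trans ?_ (hθ ⟨c T, c.shift hT.le, d, by simp [GeodesicRay.shift], hd0,
      c.endpoint_shift hT.le, hd, rfl⟩)
    refine ge_of_tendsto (hX.tendsto_rayAngle h0) ?_
    filter_upwards [Ioc_mem_nhdsGT hT] with ε hε
    exact Real.antitone_arccos (hX.comparisonCos_shift_le h hT hd0 hd hε.1 hε.2)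

/-! ### The cone metric as a growth rate -/

theorem IsHadamardSpace.tendsto_dist_div_mk (hX : IsHadamardSpace X) {c c' : GeodesicRay X}
    (h : c 0 = c' 0) (r r' : ℝ≥0) :
    Tendsto (fun t => dist (c (r * t)) (c' (r' * t)) / t) atTop
      (𝓝 (dist (BoundaryCone.mk r c.endpoint) (BoundaryCone.mk r' c'.endpoint))) := by
  obtain ⟨κ, hκ, lim, -⟩ := hX.exists_tendsto_comparisonCos h
  rw [BoundaryCone.dist_mk, hX.angle_eq h lim, Real.cos_arccos hκ.1 hκ.2]
  rcases eq_or_ne r 0 with rfl | hr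
  · refine tendsto_const_nhds.congr' ?_
    filter_upwards [eventually_gt_atTop 0] with t ht
    have : 0 ≤ (r' : ℝ) * t := mul_nonneg r'.2 ht.le
    rw [NNReal.coe_zero, zero_mul, h, c'.dist_zero this]
    simp [ht.ne']
  rcases eq_or_ne r' 0 with rfl | hr'
  · refine tendsto_const_nhds.congr' ?_
    filter_upwards [eventually_gt_atTop 0] with t ht
    have : 0 ≤ (r : ℝ) * t := mul_nonneg r.2 ht.le
    rw [NNReal.coe_zero, zero_mul, ← h, dist_comm, c.dist_zero this]
    simp [ht.ne']
  have hr0 : (0 : ℝ) < r := lt_of_le_of_ne r.2 (by exact_mod_cast hr.symm)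
  have hr0' : (0 : ℝ) < r' := lt_of_le_of_ne r'.2 (by exact_mod_cast hr'.symm)
  -- Unequal speeds are squeezed between the equal-speed cases `max r r'` and `min r r'`.
  have hcos : Tendsto (fun t : ℝ => comparisonCos c c' (r * t) (r' * t)) atTop (𝓝 κ) := by
    refine tendsto_of_tendsto_of_tendsto_of_le_of_le'
      (lim.comp (tendsto_id.const_mul_atTop (show 0 < max (r : ℝ) r' by positivity)))
      (lim.comp (tendsto_id.const_mul_atTop (show 0 < min (r : ℝ) r' from lt_min hr0 hr0'))) ?_ ?_
    · filter_upwards [eventually_gt_atTop 0] with t ht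
      exact hX.comparisonCos_le h (by positivity) (by positivity)
        (mul_le_mul_of_nonneg_right (le_max_left _ _) ht.le)
        (mul_le_mul_of_nonneg_right (le_max_right _ _) ht.le)
    · filter_upwards [eventually_gt_atTop 0] with t ht
      have : 0 < min (r : ℝ) r' * t := mul_pos (lt_min hr0 hr0') ht
      exact hX.comparisonCos_le h this this
        (mul_le_mul_of_nonneg_right (min_le_left _ _) ht.le)
        (mul_le_mul_of_nonneg_right (min_le_right _ _) ht.le)
  refine ((hcos.const_mul (2 * (r : ℝ) * r')).const_sub ((r : ℝ) ^ 2 + (r' : ℝ) ^ 2)).sqrt.congr' ?_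
  filter_upwards [eventually_gt_atTop 0] with t ht
  have e := dist_sq_eq_comparisonCos c c' (mul_pos hr0 ht) (mul_pos hr0' ht)
  rw [← Real.sqrt_sq (show 0 ≤ dist (c (r * t)) (c' (r' * t)) / t by positivity), div_pow, e]
  congr 1
  field_simp

/-- The cone metric is the asymptotic growth rate of the distance of constant-speed rays. -/
theorem IsHadamardSpace.tendsto_dist_div (hX : IsHadamardSpace X) {a b : ℝ → X}
    {p q : BoundaryCone X} (ha : IsRayTo a p) (hb : IsRayTo b q) :
    Tendsto (fun t => dist (a t) (b t) / t) atTop (𝓝 (dist p q)) := by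
  obtain ⟨c, r, hc, rfl⟩ := id ha
  obtain ⟨c', r', hc', rfl⟩ := id hb
  obtain ⟨d, hd0, hd⟩ := hX.exists_geodesicRay c' (c 0)
  have hb' := d.isRayTo r'
  rw [hd] at hb'
  obtain ⟨K, hK⟩ := hb'.exists_dist_le hb
  have := hX.tendsto_dist_div_mk hd0.symm r r'
  rw [hd] at this
  refine tendsto_dist_div_congr this (tendsto_dist_div_zero (K := 0) fun t ht => ?_)
    (tendsto_dist_div_zero hK)
  rw [hc t ht, dist_self]

/-- From a common starting point the quotient is nondecreasing in `t`, hence at most its limit. -/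
theorem IsHadamardSpace.dist_div_le (hX : IsHadamardSpace X) {a b : ℝ → X}
    {p q : BoundaryCone X} (ha : IsRayTo a p) (hb : IsRayTo b q) (h : a 0 = b 0) {t : ℝ}
    (ht : 0 < t) : dist (a t) (b t) / t ≤ dist p q := by
  refine ge_of_tendsto (hX.tendsto_dist_div ha hb) ?_
  obtain ⟨r, hr⟩ := ha.exists_isRay
  obtain ⟨r', hr'⟩ := hb.exists_isRay
  filter_upwards [eventually_ge_atTop t] with s hs
  have hs0 := ht.trans_le hs
  have := hX.dist_le_mul (hr.isSegment_zero hs0.le) (hr'.isSegment_zero hs0.le) (by simpa using h)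
    (div_mem_Icc ht.le hs)
  simp only [one_mul] at this
  rw [div_mul_cancel₀ _ hs0.ne'] at this
  rw [div_le_iff₀ ht]
  refine this.trans (le_of_eq ?_)
  ring

theorem IsHadamardSpace.eq_of_cone_dist_eq_zero (hX : IsHadamardSpace X) {p q : BoundaryCone X}
    (h : dist p q = 0) : p = q := by
  obtain ⟨a, ha⟩ := exists_isRayTo p
  obtain ⟨b, hb, h0⟩ := hX.exists_isRayTo_from q (a 0)
  have hab : ∀ t, 0 ≤ t → a t = b t := by
    intro t ht
    rcases ht.eq_or_lt with rfl | ht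
    · exact h0.symm
    · have := hX.dist_div_le ha hb h0.symm ht
      rw [h, div_le_iff₀ ht, zero_mul] at this
      exact dist_le_zero.1 this
  obtain ⟨c, r, hc, hp⟩ := id ha
  obtain ⟨c', r', hc', hq⟩ := id hb
  have hr : (r : ℝ) = r' := (c.isRay r.2).speed_eq (c'.isRay r'.2) (K := 0) fun t ht => by
    have := hab t ht
    rw [hc t ht, hc' t ht] at this
    exact (dist_eq_zero.2 this).le
  obtain rfl := NNReal.coe_injective hr
  rw [← hp, ← hq]
  refine Quotient.sound ?_
  rcases eq_or_ne r 0 with rfl | hr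
  · exact Or.inl ⟨rfl, rfl⟩
  · have hr0 : (0 : ℝ) < r := lt_of_le_of_ne r.2 (by exact_mod_cast hr.symm)
    refine Or.inr (Prod.ext rfl (Quotient.sound ⟨1, one_pos, fun t ht => ?_⟩))
    have ht' := div_nonneg ht hr0.le
    have := hab _ ht'
    rw [hc _ ht', hc' _ ht', mul_div_cancel₀ _ hr0.ne'] at this
    simp [this]

/-! ### The recession function -/

/-- If the segments from `b 0` to `m t` converge to `b`, asymptotic slope bounds for `f` at the
points `m t` are slope bounds for `f` along `b`. -/
theorem slope_le_of_tendsto_segment {f : X → ℝ} (hf : Continuous f)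
    (hconv : IsGeodesicallyConvex (fun x => (f x : EReal))) {b m : ℝ → X} {σ : ℝ → ℝ → X}
    (hσ : ∀ t, IsSegment (σ t)) (h0 : ∀ t, σ t 0 = b 0) (h1 : ∀ t, σ t 1 = m t) {u : ℝ}
    (hu : 0 < u) (lim : Tendsto (fun t => σ t (u / t)) atTop (𝓝 (b u))) {g : ℝ → ℝ} {L : EReal}
    (hg : ∀ᶠ t in atTop, (f (m t) - f (b 0)) / t ≤ g t)
    (hL : Tendsto (fun t => (g t : EReal)) atTop (𝓝 L)) :
    (((f (b u) - f (b 0)) / u : ℝ) : EReal) ≤ L := by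
  have h : Tendsto (fun t => (((f (σ t (u / t)) - f (b 0)) / u : ℝ) : EReal)) atTop
      (𝓝 (((f (b u) - f (b 0)) / u : ℝ) : EReal)) :=
    EReal.tendsto_coe.2 ((((hf.tendsto _).comp lim).sub_const _).div_const _)
  refine le_of_tendsto_of_tendsto h hL ?_
  filter_upwards [hg, eventually_ge_atTop u] with t hgt ht
  have ht0 := hu.trans_le ht
  rw [EReal.coe_le_coe_iff]
  refine le_trans ?_ hgt
  have := hconv.segment_le (hσ t) (div_mem_Icc hu.le ht)
  rw [h0, h1] at this
  have e : (f (m t) - f (b 0)) / t * u = u / t * f (m t) - u / t * f (b 0) := by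
    field_simp
  rw [div_le_iff₀ hu, e]
  linarith

theorem IsRay.slope_mono {f : X → ℝ} (hconv : IsGeodesicallyConvex (fun x => (f x : EReal)))
    {a : ℝ → X} {r : ℝ} (ha : IsRay a r) {s t : ℝ} (hs : 0 < s) (hst : s ≤ t) :
    (f (a s) - f (a 0)) / s ≤ (f (a t) - f (a 0)) / t := by
  have ht := hs.trans_le hst
  have := hconv.segment_le (ha.isSegment_zero ht.le) (div_mem_Icc hs.le hst)
  rw [div_mul_cancel₀ _ ht.ne', zero_mul, one_mul] at this
  have e : (f (a t) - f (a 0)) / t * s = s / t * f (a t) - s / t * f (a 0) := by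
    field_simp
  rw [div_le_iff₀ hs, e]
  linarith

theorem IsRay.exists_tendsto_slope {f : X → ℝ}
    (hconv : IsGeodesicallyConvex (fun x => (f x : EReal))) {a : ℝ → X} {r : ℝ} (ha : IsRay a r) :
    ∃ L : EReal, Tendsto (fun t => (((f (a t) - f (a 0)) / t : ℝ) : EReal)) atTop (𝓝 L) := by
  have mono : Monotone fun t =>
      (((f (a (max t 1)) - f (a 0)) / max t 1 : ℝ) : EReal) := fun s t hst =>
    EReal.coe_le_coe_iff.2 (ha.slope_mono hconv (by positivity) (max_le_max_right _ hst))
  refine ⟨_, (tendsto_atTop_iSup mono).congr' ?_⟩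
  filter_upwards [eventually_ge_atTop 1] with t ht
  rw [max_eq_left ht]

theorem tendsto_coe_sub_div_of_tendsto {g : ℝ → ℝ} {C : ℝ} {L : EReal}
    (h : Tendsto (fun t => (((g t - C) / t : ℝ) : EReal)) atTop (𝓝 L)) (C' : ℝ) :
    Tendsto (fun t => (((g t - C') / t : ℝ) : EReal)) atTop (𝓝 L) := by
  have h0 : Tendsto (fun t : ℝ => (((C - C') / t : ℝ) : EReal)) atTop (𝓝 ((0 : ℝ) : EReal)) :=
    EReal.tendsto_coe.2 (tendsto_const_nhds.div_atTop tendsto_id)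
  -- Addition is continuous here even for infinite `L`, because the other summand is finite.
  have hc : ContinuousAt (fun p : EReal × EReal => p.1 + p.2) (L, ((0 : ℝ) : EReal)) :=
    EReal.continuousAt_add (Or.inr (EReal.coe_ne_bot _)) (Or.inr (EReal.coe_ne_top _))
  have := hc.tendsto.comp (h.prodMk_nhds h0)
  rw [EReal.coe_zero, add_zero] at this
  refine this.congr fun t => ?_
  simp only [Function.comp]
  rw [← EReal.coe_add, ← add_div, sub_add_sub_cancel]

/-- The segments from `b 0` to `a t` converge to `b`. Exchanging two asymptotic rays turns this
one-sided bound into equality of their limits. -/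
theorem IsHadamardSpace.slope_le_of_dist_le (hX : IsHadamardSpace X) {f : X → ℝ}
    (hf : Continuous f) (hconv : IsGeodesicallyConvex (fun x => (f x : EReal))) {a b : ℝ → X}
    {r K : ℝ} (hb : IsRay b r) (hK : ∀ t, 0 ≤ t → dist (a t) (b t) ≤ K) {L : EReal}
    (hL : Tendsto (fun t => (((f (a t) - f (a 0)) / t : ℝ) : EReal)) atTop (𝓝 L)) {u : ℝ}
    (hu : 0 < u) : (((f (b u) - f (b 0)) / u : ℝ) : EReal) ≤ L := by
  choose σ hσ h0 h1 using fun t => hX.exists_isSegment (b 0) (a t)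
  refine slope_le_of_tendsto_segment hf hconv hσ h0 h1 hu ?_ (Eventually.of_forall fun _ => le_rfl)
    (tendsto_coe_sub_div_of_tendsto hL (f (b 0)))
  rw [tendsto_iff_dist_tendsto_zero]
  refine squeeze_zero' (Eventually.of_forall fun _ => dist_nonneg) ?_
    (tendsto_const_nhds.div_atTop tendsto_id : Tendsto (fun t : ℝ => u * K / t) atTop (𝓝 0))
  filter_upwards [eventually_ge_atTop u] with t ht
  have ht0 := hu.trans_le ht
  have := hX.dist_le_mul (hσ t) (hb.isSegment_zero ht0.le) (by simp [h0]) (div_mem_Icc hu.le ht)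
  rw [h1, div_mul_cancel₀ _ ht0.ne', one_mul] at this
  refine this.trans ?_
  rw [mul_div_right_comm]
  exact mul_le_mul_of_nonneg_left (hK t ht0.le) (by positivity)

theorem IsHadamardSpace.tendsto_recession (hX : IsHadamardSpace X) {f : X → ℝ}
    (hf : Continuous f) (hconv : IsGeodesicallyConvex (fun x => (f x : EReal)))
    {p : BoundaryCone X} {c : ℝ → X} (hc : IsRayTo c p) :
    Tendsto (fun t => (((f (c t) - f (c 0)) / t : ℝ) : EReal)) atTop (𝓝 (recession f p)) := by
  have hd := (exists_isRayTo p).choose_spec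
  set d := (exists_isRayTo p).choose
  obtain ⟨r, hr⟩ := hc.exists_isRay
  obtain ⟨r', hr'⟩ := hd.exists_isRay
  obtain ⟨L, hL⟩ := hr.exists_tendsto_slope hconv
  obtain ⟨L', hL'⟩ := hr'.exists_tendsto_slope hconv
  have hrec : recession f p = L' := hL'.limUnder_eq
  obtain ⟨K, hK⟩ := hc.exists_dist_le hd
  have h1 : L ≤ L' := le_of_tendsto hL <| (eventually_gt_atTop 0).mono fun u hu =>
    hX.slope_le_of_dist_le hf hconv hr (fun t ht => by rw [dist_comm]; exact hK t ht) hL' hu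
  have h2 : L' ≤ L := le_of_tendsto hL' <| (eventually_gt_atTop 0).mono fun u hu =>
    hX.slope_le_of_dist_le hf hconv hr' hK hL hu
  rw [hrec, ← le_antisymm h1 h2]
  exact hL

theorem IsHadamardSpace.recession_ne_bot (hX : IsHadamardSpace X) {f : X → ℝ}
    (hf : Continuous f) (hconv : IsGeodesicallyConvex (fun x => (f x : EReal)))
    (p : BoundaryCone X) : recession f p ≠ ⊥ := by
  obtain ⟨c, hc⟩ := exists_isRayTo p
  obtain ⟨r, hr⟩ := hc.exists_isRay
  have h : (((f (c 1) - f (c 0)) / 1 : ℝ) : EReal) ≤ recession f p :=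
    ge_of_tendsto (hX.tendsto_recession hf hconv hc) <| (eventually_ge_atTop 1).mono fun t ht =>
      EReal.coe_le_coe_iff.2 (hr.slope_mono hconv one_pos ht)
  exact ((EReal.bot_lt_coe _).trans_le h).ne'

theorem IsHadamardSpace.isPositivelyHomogeneous_recession (hX : IsHadamardSpace X) {f : X → ℝ}
    (hf : Continuous f) (hconv : IsGeodesicallyConvex (fun x => (f x : EReal))) :
    IsPositivelyHomogeneous (recession f) := by
  intro a p
  obtain ⟨γ, c, r, hγ, rfl⟩ := exists_isRayTo p
  have h1 := hX.tendsto_recession hf hconv (c.isRayTo r)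
  have h2 := hX.tendsto_recession hf hconv (c.isRayTo (a * r))
  rw [BoundaryCone.smul_mk]
  rcases eq_or_ne a 0 with rfl | ha
  -- Here `recession f p` may be `⊤`; the convention `0 * ⊤ = 0` matches the zero slope of a
  -- constant ray.
  · rw [NNReal.coe_zero, EReal.coe_zero, zero_mul (recession f _)]
    refine tendsto_nhds_unique h2 (tendsto_const_nhds.congr fun t => ?_)
    simp
  · have ha0 : (0 : ℝ) < a := lt_of_le_of_ne a.2 (by exact_mod_cast ha.symm)
    refine tendsto_nhds_unique h2 ((EReal.Tendsto.const_mul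
      (h1.comp (tendsto_id.const_mul_atTop ha0)) (Or.inl (EReal.coe_ne_bot a))
      (Or.inl (EReal.coe_ne_top a))).congr' ?_)
    filter_upwards [eventually_gt_atTop 0] with t ht
    simp only [Function.comp, id, mul_zero]
    rw [← EReal.coe_mul, NNReal.coe_mul, mul_left_comm, ← mul_assoc]
    congr 1
    field_simp

/-! ### Geodesics of the cone -/

/-- The points dividing the segments `[a t, b t]` in the ratio `l : 1 - l` converge to a ray. -/
theorem IsHadamardSpace.exists_isRay_interpolate (hX : IsHadamardSpace X) {a b : ℝ → X}
    {p q : BoundaryCone X} (ha : IsRayTo a p) (hb : IsRayTo b q) (h : a 0 = b 0)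
    {σ : ℝ → ℝ → X} (hσ : ∀ t, IsSegment (σ t)) (h0 : ∀ t, σ t 0 = a t) (h1 : ∀ t, σ t 1 = b t)
    {l : ℝ} (hl : l ∈ Set.Icc (0 : ℝ) 1) :
    ∃ (ρ : ℝ → X) (z : BoundaryCone X) (τ : ℝ → ℝ → X), IsRayTo ρ z ∧ ρ 0 = a 0 ∧
      Tendsto (fun t => dist (ρ t) (σ t l) / t) atTop (𝓝 0) ∧
      (∀ t, IsSegment (τ t)) ∧ (∀ t, τ t 0 = a 0) ∧ (∀ t, τ t 1 = σ t l) ∧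
      ∀ u, 0 ≤ u → Tendsto (fun t => τ t (u / t)) atTop (𝓝 (ρ u)) := by
  choose τ hτ hτ0 hτ1 using fun t => hX.exists_isSegment (a 0) (σ t l)
  obtain ⟨r, hr⟩ := ha.exists_isRay
  obtain ⟨r', hr'⟩ := hb.exists_isRay
  have hl0 := hl.1
  have hl1 : 0 ≤ 1 - l := sub_nonneg.2 hl.2
  -- With `D = dist p q`, the point `τ t (s / t)` is within `l * s * D` of `a s` and `(1 - l) * s *
  -- D` of `b s`. Bruhat–Tits on the segment from `a s` to `b s` then bounds its distance to `σ s l`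
  -- by `s * ε s`.
  set ε : ℝ → ℝ := fun s => √(l * (1 - l) * (dist p q ^ 2 - (dist (a s) (b s) / s) ^ 2))
  have lim : Tendsto ε atTop (𝓝 0) := by
    have := ((((hX.tendsto_dist_div ha hb).pow 2).const_sub (dist p q ^ 2)).const_mul
      (l * (1 - l))).sqrt
    simpa using this
  obtain ⟨ρ, v, hρ, hρ0, hd, hτρ⟩ := hX.exists_limit_isRay hτ hτ0 hτ1 lim (by
    intro s t hs hst
    have ht := hs.trans_le hst
    have hD : s / t * dist (a t) (b t) ≤ s * dist p q := by
      have := mul_le_mul_of_nonneg_left (hX.dist_div_le ha hb h ht) hs.le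
      rwa [mul_div_left_comm, mul_comm] at this
    have hD0 : 0 ≤ s / t * dist (a t) (b t) := by positivity
    have d1 := hX.dist_le_mul (hτ t) (hr.isSegment_zero ht.le) (by simp [hτ0])
      (div_mem_Icc hs.le hst)
    have d2 := hX.dist_le_mul (hτ t) (hr'.isSegment_zero ht.le) (by simp [hτ0, h])
      (div_mem_Icc hs.le hst)
    rw [hτ1, div_mul_cancel₀ _ ht.ne', one_mul, ← h0 t, hσ t l hl 0 ⟨le_rfl, zero_le_one⟩, h0, h1,
      sub_zero, abs_of_nonneg hl0, mul_left_comm] at d1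
    rw [hτ1, div_mul_cancel₀ _ ht.ne', one_mul, ← h1 t, hσ t l hl 1 ⟨zero_le_one, le_rfl⟩, h0, h1,
      abs_sub_comm, abs_of_nonneg hl1, mul_left_comm] at d2
    have d1' := pow_le_pow_left₀ dist_nonneg (d1.trans (mul_le_mul_of_nonneg_left hD hl0)) 2
    have d2' := pow_le_pow_left₀ dist_nonneg (d2.trans (mul_le_mul_of_nonneg_left hD hl1)) 2
    have key := hX.dist_sq_segment_le (hσ s) (τ t (s / t)) hl
    rw [h0, h1, dist_comm (a s), dist_comm (b s) (τ t _), dist_comm (σ s l)] at key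
    rw [mul_comm, ← div_le_iff₀ hs]
    refine Real.le_sqrt_of_sq_le ?_
    rw [div_pow, div_le_iff₀ (by positivity), div_pow]
    have e : l * (1 - l) * (dist p q ^ 2 - dist (a s) (b s) ^ 2 / s ^ 2) * s ^ 2 =
        (1 - l) * (l * (s * dist p q)) ^ 2 + l * ((1 - l) * (s * dist p q)) ^ 2
          - l * (1 - l) * dist (a s) (b s) ^ 2 := by
      field_simp
      ring
    rw [e]
    have := mul_le_mul_of_nonneg_left d1' hl1
    have := mul_le_mul_of_nonneg_left d2' hl0
    linarith)
  obtain ⟨c, -, -, -⟩ := id ha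
  obtain ⟨z, hz⟩ := hX.exists_endpoint c.endpoint hρ
  refine ⟨ρ, z, τ, hz, hρ0, ?_, hτ, hτ0, hτ1, hτρ⟩
  refine squeeze_zero' ?_ ?_ lim
  all_goals filter_upwards [eventually_gt_atTop 0] with t ht
  · positivity
  · rw [div_le_iff₀ ht, mul_comm]
    exact hd t ht

/-- All three properties are limits of statements about the points `σ t l`, rescaled by `t`. The
family `z` is chosen before `f`, so it serves every convex function. -/
theorem IsHadamardSpace.exists_cone_segment (hX : IsHadamardSpace X) (p q : BoundaryCone X) :
    ∃ z : ℝ → BoundaryCone X,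
      (∀ l ∈ Set.Icc (0 : ℝ) 1, ∀ w, dist (z l) w ^ 2 ≤
        (1 - l) * dist p w ^ 2 + l * dist q w ^ 2 - l * (1 - l) * dist p q ^ 2) ∧
      (∀ l ∈ Set.Icc (0 : ℝ) 1, ∀ k ∈ Set.Icc (0 : ℝ) 1,
        dist (z l) (z k) = |l - k| * dist p q) ∧
      ∀ f : X → ℝ, Continuous f → IsGeodesicallyConvex (fun x => (f x : EReal)) →
        ∀ l ∈ Set.Icc (0 : ℝ) 1, recession f (z l) ≤
          ((1 - l : ℝ) : EReal) * recession f p + ((l : ℝ) : EReal) * recession f q := by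
  obtain ⟨a, ha⟩ := exists_isRayTo p
  obtain ⟨b, hb, h⟩ := hX.exists_isRayTo_from q (a 0)
  choose σ hσ h0 h1 using fun t => hX.exists_isSegment (a t) (b t)
  have key : ∀ l, ∃ (ρ : ℝ → X) (z : BoundaryCone X) (τ : ℝ → ℝ → X), l ∈ Set.Icc (0 : ℝ) 1 →
      IsRayTo ρ z ∧ ρ 0 = a 0 ∧ Tendsto (fun t => dist (ρ t) (σ t l) / t) atTop (𝓝 0) ∧
      (∀ t, IsSegment (τ t)) ∧ (∀ t, τ t 0 = a 0) ∧ (∀ t, τ t 1 = σ t l) ∧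
      ∀ u, 0 ≤ u → Tendsto (fun t => τ t (u / t)) atTop (𝓝 (ρ u)) := by
    intro l
    by_cases hl : l ∈ Set.Icc (0 : ℝ) 1
    · obtain ⟨ρ, z, τ, H⟩ := hX.exists_isRay_interpolate ha hb h.symm hσ h0 h1 hl
      exact ⟨ρ, z, τ, fun _ => H⟩
    · exact ⟨a, p, σ, fun hl' => absurd hl' hl⟩
  choose ρ z τ H using key
  refine ⟨z, fun l hl w => ?_, fun l hl k hk => ?_, fun f hf hconv l hl => ?_⟩
  · obtain ⟨hz, -, hs, -⟩ := H l hl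
    obtain ⟨e, he⟩ := exists_isRayTo w
    have l1 := tendsto_dist_div_congr (hX.tendsto_dist_div hz he) hs
      (tendsto_dist_div_zero (K := 0) fun t _ => (dist_self (e t)).le)
    have l2 := ((((hX.tendsto_dist_div ha he).pow 2).const_mul (1 - l)).add
      (((hX.tendsto_dist_div hb he).pow 2).const_mul l)).sub
      (((hX.tendsto_dist_div ha hb).pow 2).const_mul (l * (1 - l)))
    refine le_of_tendsto_of_tendsto (l1.pow 2) l2 ?_
    filter_upwards [eventually_gt_atTop 0] with t ht
    have := hX.dist_sq_segment_le (hσ t) (e t) hl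
    rw [h0, h1] at this
    simp only [div_pow]
    rw [div_le_iff₀ (by positivity)]
    refine this.trans_eq ?_
    field_simp
  · obtain ⟨hz, -, hs, -⟩ := H l hl
    obtain ⟨hz', -, hs', -⟩ := H k hk
    refine tendsto_nhds_unique (tendsto_dist_div_congr (hX.tendsto_dist_div hz hz') hs hs')
      (((hX.tendsto_dist_div ha hb).const_mul |l - k|).congr fun t => ?_)
    rw [hσ t l hl k hk, h0, h1, mul_div_assoc]
  · obtain ⟨hz, hρ0, -, hτ, hτ0, hτ1, hτρ⟩ := H l hl
    have hl1 : 0 ≤ 1 - l := sub_nonneg.2 hl.2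
    -- Excludes `⊥ + ⊤`, where addition on `EReal` is discontinuous.
    have hmul : ∀ {k : ℝ} (_ : 0 ≤ k) (y : BoundaryCone X), (k : EReal) * recession f y ≠ ⊥ := by
      intro k hk y
      rw [EReal.mul_ne_bot]
      exact ⟨Or.inl (EReal.coe_ne_bot _), Or.inr (hX.recession_ne_bot hf hconv y),
        Or.inl (EReal.coe_ne_top _), Or.inl (by exact_mod_cast hk)⟩
    have hscale : ∀ (k : ℝ) {c : ℝ → X} {y : BoundaryCone X} (_ : IsRayTo c y),
        Tendsto (fun t => ((k : ℝ) : EReal) * (((f (c t) - f (c 0)) / t : ℝ) : EReal)) atTop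
          (𝓝 ((k : EReal) * recession f y)) := fun k c y hc =>
      EReal.Tendsto.const_mul (hX.tendsto_recession hf hconv hc) (Or.inl (EReal.coe_ne_bot _))
        (Or.inl (EReal.coe_ne_top _))
    have hlim := (EReal.continuousAt_add (p := (_, _)) (Or.inr (hmul hl.1 q))
      (Or.inl (hmul hl1 p))).tendsto.comp ((hscale (1 - l) ha).prodMk_nhds (hscale l hb))
    refine le_of_tendsto (hX.tendsto_recession hf hconv hz) ?_
    filter_upwards [eventually_gt_atTop 0] with u hu
    refine slope_le_of_tendsto_segment hf hconv hτ (fun t => (hτ0 t).trans hρ0.symm) hτ1 hu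
      (hτρ u hu.le) (g := fun t => (1 - l) * ((f (a t) - f (a 0)) / t)
        + l * ((f (b t) - f (b 0)) / t)) ?_ ?_
    · filter_upwards [eventually_gt_atTop 0] with t ht
      have := hconv.segment_le (hσ t) hl
      rw [h0, h1] at this
      rw [hρ0, h, div_le_iff₀ ht]
      refine (sub_le_sub_right this _).trans_eq ?_
      field_simp
      ring
    · refine hlim.congr fun t => ?_
      simp only [Function.comp]
      push_cast
      rfl

theorem IsHadamardSpace.cone_dist_self (hX : IsHadamardSpace X) (p : BoundaryCone X) :
    dist p p = 0 := by
  obtain ⟨a, ha⟩ := exists_isRayTo p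
  exact tendsto_nhds_unique (hX.tendsto_dist_div ha ha)
    (tendsto_dist_div_zero (K := 0) fun t _ => (dist_self (a t)).le)

/-- Test the inequality for `z` at `w = γ (l * d)`: the right side is `(1 - l) * l ^ 2 * d ^ 2 + l *
(1 - l) ^ 2 * d ^ 2 - l * (1 - l) * d ^ 2 = 0`. -/
theorem IsHadamardSpace.cone_geodesic_eq (hX : IsHadamardSpace X) {p q z : BoundaryCone X}
    {γ : ℝ → BoundaryCone X} {d l : ℝ} (hγ : IsGeodesicPath γ d p q) (hl : l ∈ Set.Icc (0 : ℝ) 1)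
    (hz : ∀ w, dist z w ^ 2 ≤
      (1 - l) * dist p w ^ 2 + l * dist q w ^ 2 - l * (1 - l) * dist p q ^ 2) :
    γ (l * d) = z := by
  have hd := hγ.length_nonneg
  have hmem : l * d ∈ Set.Icc 0 d := ⟨mul_nonneg hl.1 hd, mul_le_of_le_one_left hd hl.2⟩
  have h1 := hγ.dist_eq 0 ⟨le_rfl, hd⟩ _ hmem
  have h2 := hγ.dist_eq d ⟨hd, le_rfl⟩ _ hmem
  have := hz (γ (l * d))
  rw [hγ.source] at h1
  rw [hγ.target] at h2
  rw [h1, h2, ← hγ.length_eq, sq_abs, sq_abs] at this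
  refine (hX.eq_of_cone_dist_eq_zero ?_).symm
  refine pow_eq_zero_iff two_ne_zero |>.1 (le_antisymm (this.trans_eq ?_) (sq_nonneg _))
  ring

theorem IsHadamardSpace.isUniquelyGeodesic_boundaryCone (hX : IsHadamardSpace X) :
    IsUniquelyGeodesic (BoundaryCone X) := by
  refine ⟨fun p q => ?_, fun p q γ γ' d d' h h' => ?_⟩
  · obtain ⟨z, hz, hdist, -⟩ := hX.exists_cone_segment p q
    have hd : 0 ≤ dist p q := by
      obtain ⟨a, ha⟩ := exists_isRayTo p
      obtain ⟨b, hb⟩ := exists_isRayTo q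
      refine ge_of_tendsto (hX.tendsto_dist_div ha hb) ?_
      filter_upwards [eventually_gt_atTop 0] with t ht
      positivity
    have hz0 : z 0 = p := by
      refine hX.eq_of_cone_dist_eq_zero ?_
      have := hz 0 ⟨le_rfl, zero_le_one⟩ p
      rw [hX.cone_dist_self] at this
      exact pow_eq_zero_iff two_ne_zero |>.1 (le_antisymm (by simpa using this) (sq_nonneg _))
    have hz1 : z 1 = q := by
      refine hX.eq_of_cone_dist_eq_zero ?_
      have := hz 1 ⟨zero_le_one, le_rfl⟩ q
      rw [hX.cone_dist_self q] at this
      exact pow_eq_zero_iff two_ne_zero |>.1 (le_antisymm (by simpa using this) (sq_nonneg _))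
    refine ⟨fun s => z (s / dist p q), dist p q, hd, by simp [hz0], ?_, ?_⟩
    · rcases hd.eq_or_lt with h0 | h0
      · simp only [← h0, div_zero, hz0]
        exact hX.eq_of_cone_dist_eq_zero h0.symm
      · simp only [div_self h0.ne', hz1]
    · intro s hs t ht
      rw [hdist _ (div_mem_Icc hs.1 hs.2) _ (div_mem_Icc ht.1 ht.2), ← sub_div, abs_div,
        abs_of_nonneg hd]
      rcases hd.eq_or_lt with h0 | h0
      · rw [← h0, Set.Icc_self, Set.mem_singleton_iff] at hs ht
        simp [hs, ht]
      · rw [div_mul_cancel₀ _ h0.ne']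
  · have hdd : d = d' := h.length_eq.trans h'.length_eq.symm
    subst hdd
    refine ⟨rfl, fun s hs => ?_⟩
    obtain ⟨z, hz, -⟩ := hX.exists_cone_segment p q
    have hs' := div_mem_Icc hs.1 hs.2
    have e : s / d * d = s := by
      rcases h.length_nonneg.eq_or_lt with h0 | h0
      · rw [← h0, Set.Icc_self, Set.mem_singleton_iff] at hs
        simp [hs]
      · exact div_mul_cancel₀ _ h0.ne'
    have h1 := hX.cone_geodesic_eq h hs' (hz _ hs')
    have h2 := hX.cone_geodesic_eq h' hs' (hz _ hs')
    rw [e] at h1 h2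
    rw [h1, h2]

theorem IsHadamardSpace.isGeodesicallyConvex_recession (hX : IsHadamardSpace X) {f : X → ℝ}
    (hf : Continuous f) (hconv : IsGeodesicallyConvex (fun x => (f x : EReal))) :
    IsGeodesicallyConvex (recession f) := by
  intro p q γ d hγ l hl
  obtain ⟨z, hz, -, hrec⟩ := hX.exists_cone_segment p q
  rw [hX.cone_geodesic_eq hγ hl (hz l hl)]
  exact hrec f hf hconv l hl

end Hadamard

theorem mainTheorem3 {X : Type*} [MetricSpace X] (hX : Hadamard.IsHadamardSpace X)
    (f : X → ℝ) (hf_cont : Continuous f)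
    (hf_conv : Hadamard.IsGeodesicallyConvex (fun x => (f x : EReal))) :
    -- the recession function is well defined, with values in `ℝ ∪ {∞}`
    (∀ (p : Hadamard.BoundaryCone X) (c : ℝ → X), Hadamard.IsRayTo c p →
      Tendsto (fun t : ℝ => (((f (c t) - f (c 0)) / t : ℝ) : EReal)) atTop
          (𝓝 (Hadamard.recession f p)) ∧
        Tendsto (fun t : ℝ => ((f (c t) / t : ℝ) : EReal)) atTop
          (𝓝 (Hadamard.recession f p))) ∧
    (∀ p : Hadamard.BoundaryCone X, Hadamard.recession f p ≠ ⊥) ∧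
    -- the cone of the boundary is uniquely geodesic, so that convexity on it is meaningful
    Hadamard.IsUniquelyGeodesic (Hadamard.BoundaryCone X) ∧
    Hadamard.IsPositivelyHomogeneous (Hadamard.recession f) ∧
    Hadamard.IsGeodesicallyConvex (Hadamard.recession f) := by
  have lim := fun {p : Hadamard.BoundaryCone X} {c : ℝ → X} (hc : Hadamard.IsRayTo c p) =>
    hX.tendsto_recession hf_cont hf_conv hc
  refine ⟨fun p c hc => ⟨lim hc, ?_⟩, hX.recession_ne_bot hf_cont hf_conv,
    hX.isUniquelyGeodesic_boundaryCone, hX.isPositivelyHomogeneous_recession hf_cont hf_conv,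
    hX.isGeodesicallyConvex_recession hf_cont hf_conv⟩
  -- Replacing the subtracted constant `f (c 0)` by `0` does not affect the limit.
  simpa using Hadamard.tendsto_coe_sub_div_of_tendsto (lim hc) 0
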